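/- For an integer $\alpha$, let $G(\alpha)=\langle A,B\mid A^{[A,B]}=A^\alpha,\ B^{[B,A]}=B^\alpha\rangle$ be the Macdonald group, where $[a,b]=a^{-1}b^{-1}ab$ and $b^a=a^{-1}ba$. Then, for every $\alpha\in\mathbb{Z}$, the group $G(\alpha)$ is nilpotent, of nilpotency class at most $7$. -/

import Mathlib

/-- The commutator `[a, b] = a⁻¹ b⁻¹ a b`. (Mathlib's `⁅a, b⁆` is `a b a⁻¹ b⁻¹`.) -/
def groupComm {T : Type*} [Group T] (a b : T) : T := a⁻¹ * b⁻¹ * a * b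

/-- Right conjugation `b ^ a = a⁻¹ b a`, written `rightConj b a`. -/
def rightConj {T : Type*} [Group T] (b a : T) : T := a⁻¹ * b * a

/-- The relators `A^{[A,B]} A^{-α}` and `B^{[B,A]} B^{-α}` in the free group on
`A = FreeGroup.of 0` and `B = FreeGroup.of 1`. -/
def macdonaldRels (α : ℤ) : Set (FreeGroup (Fin 2)) :=
  let A : FreeGroup (Fin 2) := FreeGroup.of 0
  let B : FreeGroup (Fin 2) := FreeGroup.of 1
  {rightConj A (groupComm A B) * (A ^ α)⁻¹, rightConj B (groupComm B A) * (B ^ α)⁻¹}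

/-- The Macdonald group `G(α) = ⟨A, B | A^{[A,B]} = A^α, B^{[B,A]} = B^α⟩`. -/
abbrev MacdonaldGroup (α : ℤ) : Type := PresentedGroup (macdonaldRels α)

/-! Everything happens in a group generated by `a` and `b` with `c = [a, b]`, and swapping `a` with
`b` while inverting `c` preserves the relations. Rewriting words in two ways shows that a power of
`b` is conjugate, by a power of `c`, to a power of `a`. Such a power of `a` is central
(`commute_zpow_of_pos`, `commute_zpow_of_neg`). A second source, `commute_zpow_of_central`, turns
one central exponent into another.

Since `c` acts on `a` by raising to the power `α`, a central `a ^ y` satisfies `a ^ (y * (α - 1)) =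
1`. So for `α ≠ 1` the generators have finite order, `α` may be shifted by a multiple of a common
exponent, and one may take `α = t + 1` with `t > 0`. Then only primes dividing `t` occur in the
orders (`exists_pow_pow_eq_one`), and any factor of a central exponent prime to `t` can be dropped.

Let `D` be `t ^ 2` for odd `t` and `t ^ 2 / 2` for even `t`. Expanding the central exponent in
powers of `t` shows that `D` is a central exponent if `3 ∤ t`, and `3 * D` if `3 ∣ t`. When `α ≡ -2`
mod `27` the expansion alone does not bound the power of `3`, and the second source supplies an
exponent that is `27` times a number prime to `3`.

Finally `mem_upperCentralSeries_add_two` trades two steps of the upper central series for a smaller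
exponent: `D, t, 1` gives class at most `5`, and `3 * D, 3 * t, t, 1` gives class at most `7`. -/

/-- The triples `(a, b, c)` with `c = [a, b]`, `a ^ c = a ^ α` and `b ^ c⁻¹ = b ^ α`. -/
structure IsMacdonaldTriple {H : Type*} [Group H] (α : ℤ) (a b c : H) : Prop where
  comm : a * b = b * a * c
  left : a * c = c * a ^ α
  right : c * b = b ^ α * c

/-- The sum `α + α ^ 2 + ⋯ + α ^ n`. -/
def powSum (α : ℤ) (n : ℕ) : ℤ := ∑ i ∈ Finset.range n, α ^ (i + 1)

theorem powSum_succ (α : ℤ) (n : ℕ) : powSum α (n + 1) = α * (powSum α n + 1) := by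
  unfold powSum
  rw [Finset.sum_range_succ', mul_add, Finset.mul_sum]
  simp [pow_succ, mul_comm]

theorem powSum_mul (α : ℤ) (n : ℕ) : powSum α n * (α - 1) = α * (α ^ n - 1) := by
  induction n with
  | zero => simp [powSum]
  | succ n ih => rw [powSum_succ]; linear_combination α * ih

/-! ### Commutation rules and the first central powers. -/

namespace IsMacdonaldTriple

variable {H : Type*} [Group H] {α : ℤ} {a b c : H}

theorem symm (h : IsMacdonaldTriple α a b c) : IsMacdonaldTriple α b a c⁻¹ where
  comm := by rw [h.comm]; group
  left := by
    rw [eq_inv_mul_iff_mul_eq, ← mul_assoc, h.right]; group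
  right := by
    rw [inv_mul_eq_iff_eq_mul, ← mul_assoc, ← h.left]; group

theorem zpow_mul_pow (h : IsMacdonaldTriple α a b c) (x : ℤ) (n : ℕ) :
    a ^ x * c ^ n = c ^ n * a ^ (x * α ^ n) := by
  induction n generalizing x with
  | zero => simp
  | succ n ih =>
    have h1 : SemiconjBy c (a ^ α) a := h.left.symm
    have h2 : c * a ^ (α * x) = a ^ x * c := by rw [zpow_mul]; exact h1.zpow_right x
    rw [pow_succ' c, ← mul_assoc, ← h2, mul_assoc, ih, ← mul_assoc]
    congr 2; ring

theorem pow_mul_zpow (h : IsMacdonaldTriple α a b c) (x : ℤ) (n : ℕ) :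
    c ^ n * b ^ x = b ^ (x * α ^ n) * c ^ n := by
  have := h.symm.zpow_mul_pow x n
  rw [inv_pow, mul_inv_eq_iff_eq_mul] at this
  rw [this]; group

/-- Conjugation by `b` sends `a` to `a * c`; the formula collects the letters `c` of `(a * c) ^ n`
on the left. -/
theorem pow_mul_eq (h : IsMacdonaldTriple α a b c) (n : ℕ) :
    a ^ n * b = b * (c ^ n * a ^ powSum α n) := by
  induction n with
  | zero => simp [powSum]
  | succ n ih =>
    have h1 := h.zpow_mul_pow (powSum α n + 1) 1
    simp only [pow_one] at h1
    calc a ^ (n + 1) * b = a ^ n * (a * b) := by rw [pow_succ, mul_assoc]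
      _ = a ^ n * b * (a * c) := by rw [h.comm]; simp only [mul_assoc]
      _ = b * c ^ n * (a ^ (powSum α n + 1) * c) := by rw [ih, zpow_add_one]; simp only [mul_assoc]
      _ = _ := by rw [h1, powSum_succ, mul_comm α, pow_succ]; simp only [mul_assoc]

theorem pow_conj (h : IsMacdonaldTriple α a b c) (y : ℤ) (k : ℕ) :
    (c ^ k * a ^ y * (c ^ k)⁻¹) ^ (α ^ k) = a ^ y := by
  rw [conj_zpow, ← zpow_mul, ← h.zpow_mul_pow]; group

/-- By `pow_conj`, `a ^ y` is a power of its own conjugate by `c ^ k`, so it commutes with whatever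
that conjugate commutes with. -/
theorem commute_of_conj (h : IsMacdonaldTriple α a b c) {y : ℤ} {k : ℕ}
    (hc : Commute (c ^ k * a ^ y * (c ^ k)⁻¹) b) : Commute (a ^ y) b := by
  have := hc.zpow_left (α ^ k)
  rwa [h.pow_conj] at this

theorem conj_comm_left (h : IsMacdonaldTriple α a b c) : c * a = a * (c * a ^ (1 - α)) := by
  rw [← mul_assoc, h.left, mul_assoc, ← zpow_add]; simp

/-- For `α = m ≥ 1`, conjugating `c b = b ^ α c` by `a` gives a central power of `a`. -/
theorem commute_zpow_of_pos {t : ℕ} (h : IsMacdonaldTriple ((t : ℤ) + 1) a b c) :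
    Commute (a ^ (((t : ℤ) + 1) ^ (t + 2) - powSum (t + 1) (t + 1))) b := by
  set α : ℤ := (t : ℤ) + 1 with hα
  have e1 : b ^ (t + 1) * a = a * ((c ^ (t + 1))⁻¹ * b ^ powSum α (t + 1)) := by
    have := h.symm.pow_mul_eq (t + 1); rwa [inv_pow] at this
  have e2 : b ^ α * c * a = c * b * a := by rw [h.right]
  have e3 : c * a = a * (c * a ^ (-(t : ℤ))) := by
    have := h.conj_comm_left; rwa [show 1 - α = -(t : ℤ) by rw [hα]; ring] at this
  have e4 : a ^ (-(t : ℤ)) * b = b * (a ^ (-powSum α t) * (c ^ t)⁻¹) := by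
    rw [zpow_neg, inv_mul_eq_iff_eq_mul, zpow_natCast, ← mul_assoc, h.pow_mul_eq]; group
  have e5 : b * a = a * (b * c⁻¹) := by rw [← mul_assoc, h.comm]; group
  have e6 : b ^ α = b ^ (t + 1) := by rw [hα]; exact_mod_cast zpow_natCast b (t + 1)
  have L : c * b * a = a * (c * b * a ^ (-powSum α t) * (c ^ (t + 1))⁻¹) := by
    calc c * b * a = c * a * (b * c⁻¹) := by rw [mul_assoc, e5]; simp only [mul_assoc]
      _ = a * c * (a ^ (-(t : ℤ)) * b) * c⁻¹ := by rw [e3]; simp only [mul_assoc]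
      _ = _ := by rw [e4, pow_succ', mul_inv_rev]; simp only [mul_assoc]
  have R : b ^ α * c * a = a * ((c ^ (t + 1))⁻¹ * b ^ powSum α (t + 1) * c * a ^ (-(t : ℤ))) := by
    calc b ^ α * c * a = b ^ (t + 1) * a * (c * a ^ (-(t : ℤ))) := by
          rw [mul_assoc, e3, e6]; simp only [mul_assoc]
      _ = _ := by rw [e1]; simp only [mul_assoc]
  have key := mul_left_cancel (L.symm.trans (e2.symm.trans R))
  have f1 := h.pow_mul_zpow 1 (t + 2)
  have f2 := h.zpow_mul_pow (-(t : ℤ)) (t + 1)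
  rw [zpow_one, one_mul] at f1
  have f3 : b ^ (α ^ (t + 2)) * c ^ (t + 2) * a ^ (-powSum α t) * (c ^ (t + 1))⁻¹ =
      b ^ powSum α (t + 1) * c * a ^ (-(t : ℤ)) := by
    rw [← f1, pow_succ c (t + 1)]
    have := congrArg (fun z => c ^ (t + 1) * z) key
    simp only [← mul_assoc, mul_inv_cancel, one_mul] at this
    simpa only [← mul_assoc] using this
  have hP : powSum α (t + 1) - α ^ (t + 2) = -(t : ℤ) * α ^ (t + 1) + powSum α t := by
    have : powSum α (t + 1) = powSum α t + α ^ (t + 1) := Finset.sum_range_succ _ _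
    rw [this, hα]; ring
  -- The two evaluations of `c * b * a` now say that a power of `b` is a `c ^ (t + 2)`-conjugate of
  -- a power of `a`.
  have f4 : b ^ (-(powSum α (t + 1) - α ^ (t + 2))) =
      c ^ (t + 2) * a ^ (powSum α (t + 1) - α ^ (t + 2)) * (c ^ (t + 2))⁻¹ := by
    have g1 : b ^ (-(powSum α (t + 1) - α ^ (t + 2))) =
        (b ^ powSum α (t + 1))⁻¹ * b ^ (α ^ (t + 2)) := by
      rw [← zpow_neg, ← zpow_add]; congr 1; ring
    have g2 : b ^ (α ^ (t + 2)) = b ^ powSum α (t + 1) * c * a ^ (-(t : ℤ)) * c ^ (t + 1) *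
        a ^ powSum α t * (c ^ (t + 2))⁻¹ := by
      rw [← f3]; group
    rw [g1, g2, hP, zpow_add, mul_assoc _ (a ^ (-(t : ℤ))), f2, pow_succ' c (t + 1)]; group
  have f5 : Commute (a ^ (powSum α (t + 1) - α ^ (t + 2))) b :=
    h.commute_of_conj (k := t + 2) (by rw [← f4]; exact (Commute.refl b).zpow_left _)
  have := f5.inv_left
  rwa [← zpow_neg, neg_sub] at this

/-- For `α = -n`, conjugating `c b = b ^ α c` by `a` gives a central power of `a`. -/
theorem commute_zpow_of_neg {n : ℕ} (h : IsMacdonaldTriple (-(n : ℤ)) a b c) :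
    Commute (a ^ ((n : ℤ) * (powSum (-n) n - n))) b := by
  set α : ℤ := -(n : ℤ) with hα
  have e1 : b ^ n * a = a * ((c ^ n)⁻¹ * b ^ powSum α n) := by
    have := h.symm.pow_mul_eq n; rwa [inv_pow] at this
  have e0 : b ^ n = c * b⁻¹ * c⁻¹ := by
    have h2 : b ^ α = c * b * c⁻¹ := by rw [eq_mul_inv_iff_mul_eq, h.right]
    rw [← zpow_natCast, show (n : ℤ) = -α by rw [hα]; ring, zpow_neg, h2]; group
  have e3 : c * a = a * (c * a ^ (n + 1)) := by
    have := h.conj_comm_left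
    rwa [show 1 - α = ((n + 1 : ℕ) : ℤ) by rw [hα]; push_cast; ring, zpow_natCast] at this
  have e3' : c⁻¹ * a = a * (a ^ (n + 1))⁻¹ * c⁻¹ := by
    rw [inv_mul_eq_iff_eq_mul, ← mul_assoc, ← mul_assoc, e3]; group
  have e4 : b⁻¹ * (a ^ (n + 1))⁻¹ =
      (a ^ powSum α (n + 1))⁻¹ * (c ^ (n + 1))⁻¹ * b⁻¹ := by
    rw [← mul_inv_rev, h.pow_mul_eq]; group
  have e5 : b⁻¹ * a = a * (c * b⁻¹) := by
    rw [inv_mul_eq_iff_eq_mul, ← mul_assoc, ← mul_assoc, ← h.comm]; group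
  have e7 : b⁻¹ * c⁻¹ = c⁻¹ * b ^ n := by rw [e0]; group
  have L : b ^ n * a = a * (c * a ^ (n + 1) * c * (a ^ powSum α (n + 1))⁻¹ *
      (c ^ (n + 2))⁻¹ * b ^ n) := by
    calc b ^ n * a = c * b⁻¹ * (c⁻¹ * a) := by rw [e0, mul_assoc]
      _ = c * (b⁻¹ * a) * (a ^ (n + 1))⁻¹ * c⁻¹ := by rw [e3']; simp only [mul_assoc]
      _ = c * a * c * (b⁻¹ * (a ^ (n + 1))⁻¹) * c⁻¹ := by rw [e5]; simp only [mul_assoc]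
      _ = c * a * c * ((a ^ powSum α (n + 1))⁻¹ * (c ^ (n + 1))⁻¹) * (b⁻¹ * c⁻¹) := by
        rw [e4]; simp only [mul_assoc]
      _ = _ := by rw [e7, e3, pow_succ' c (n + 1), mul_inv_rev]; simp only [mul_assoc]
  have key := mul_left_cancel (e1.symm.trans L)
  have f1 := h.zpow_mul_pow ((n : ℤ) + 1) 1
  rw [pow_one, pow_one] at f1
  have hQ : (n : ℤ) * (powSum α n - n) = ((n : ℤ) + 1) * α - powSum α (n + 1) := by
    rw [powSum_succ, hα]; ring
  have f4 : b ^ (powSum α n - n) =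
      c ^ (n + 2) * a ^ ((n : ℤ) * (powSum α n - n)) * (c ^ (n + 2))⁻¹ := by
    have g1 : b ^ (powSum α n - n) = b ^ powSum α n * (b ^ n)⁻¹ := by
      rw [zpow_sub, zpow_natCast]
    have g2 : b ^ powSum α n = c ^ n * (c * a ^ (n + 1) * c * (a ^ powSum α (n + 1))⁻¹ *
      (c ^ (n + 2))⁻¹ * b ^ n) := by rw [← key]; group
    have g3 : a ^ (n + 1) * c = c * a ^ (((n : ℤ) + 1) * α) := by
      rw [← f1, ← zpow_natCast]; push_cast; rfl
    rw [g1, g2, hQ, zpow_sub, mul_assoc c, g3, pow_succ c (n + 1), pow_succ c n]; group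
  exact h.commute_of_conj (k := n + 2) (by rw [← f4]; exact (Commute.refl b).zpow_left _)

end IsMacdonaldTriple

/-! ### Central exponents, a second source of them, and the upper central series. -/

open Subgroup

theorem mem_center_of_closure_pair {H : Type*} [Group H] {a b g : H}
    (hg : closure ({a, b} : Set H) = ⊤) (ha : Commute g a) (hb : Commute g b) :
    g ∈ center H := by
  have : closure ({a, b} : Set H) ≤ centralizer {g} := by
    rw [closure_le]
    rintro x (rfl | rfl)
    · exact mem_centralizer_singleton_iff.2 ha.symm
    · exact mem_centralizer_singleton_iff.2 hb.symm
  rw [hg] at this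
  rw [mem_center_iff]
  exact fun x => mem_centralizer_singleton_iff.1 (this (mem_top x))

/-- The exponents `x` for which `a ^ x` and `b ^ x` are central. -/
def centralExponents {H : Type*} [Group H] (a b : H) : AddSubgroup ℤ where
  carrier := {x | a ^ x ∈ center H ∧ b ^ x ∈ center H}
  zero_mem' := by simp [one_mem]
  add_mem' := by
    rintro x y ⟨h1, h2⟩ ⟨h3, h4⟩
    exact ⟨by rw [zpow_add]; exact mul_mem h1 h3, by rw [zpow_add]; exact mul_mem h2 h4⟩
  neg_mem' := by
    rintro x ⟨h1, h2⟩
    exact ⟨by rw [zpow_neg]; exact inv_mem h1, by rw [zpow_neg]; exact inv_mem h2⟩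

theorem AddSubgroup.mem_of_dvd_int {Z : AddSubgroup ℤ} {x y : ℤ} (hx : x ∈ Z) (h : x ∣ y) :
    y ∈ Z := by
  obtain ⟨k, rfl⟩ := h
  have := Z.zsmul_mem hx k
  rwa [smul_eq_mul, mul_comm] at this

theorem AddSubgroup.mem_of_isCoprime_int {Z : AddSubgroup ℤ} {d x y : ℤ} (hx : d * x ∈ Z)
    (hy : d * y ∈ Z) (h : IsCoprime x y) : d ∈ Z := by
  obtain ⟨u, v, huv⟩ := h
  have := Z.add_mem (mem_of_dvd_int hx (Dvd.intro u rfl)) (mem_of_dvd_int hy (Dvd.intro v rfl))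
  rwa [show d * x * u + d * y * v = d by linear_combination d * huv] at this

namespace IsMacdonaldTriple

variable {H : Type*} [Group H] {α : ℤ} {a b c : H}

/-- Conjugation by `c` both fixes `a ^ y` and raises it to the power `α`. -/
theorem zpow_mul_sub_one (h : IsMacdonaldTriple α a b c) {y : ℤ} (hy : a ^ y ∈ center H) :
    a ^ (y * (α - 1)) = 1 := by
  have h1 := h.zpow_mul_pow y 1
  rw [pow_one, pow_one, ← mem_center_iff.1 hy c] at h1
  rw [mul_sub, zpow_sub, ← mul_left_cancel h1]; simp

theorem mem_centralExponents_of_pos {t : ℕ} (h : IsMacdonaldTriple ((t : ℤ) + 1) a b c)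
    (hg : closure ({a, b} : Set H) = ⊤) :
    ((t : ℤ) + 1) ^ (t + 2) - powSum (t + 1) (t + 1) ∈ centralExponents a b :=
  ⟨mem_center_of_closure_pair hg ((Commute.refl a).zpow_left _) h.commute_zpow_of_pos,
   mem_center_of_closure_pair hg h.symm.commute_zpow_of_pos ((Commute.refl b).zpow_left _)⟩

theorem mem_centralExponents_of_neg {n : ℕ} (h : IsMacdonaldTriple (-(n : ℤ)) a b c)
    (hg : closure ({a, b} : Set H) = ⊤) :
    (n : ℤ) * (powSum (-n) n - n) ∈ centralExponents a b :=
  ⟨mem_center_of_closure_pair hg ((Commute.refl a).zpow_left _) h.commute_zpow_of_neg,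
   mem_center_of_closure_pair hg h.symm.commute_zpow_of_neg ((Commute.refl b).zpow_left _)⟩

theorem mul_pow_pow (h : IsMacdonaldTriple α a b c) (n j : ℕ) :
    (b * c ^ n) ^ j = b ^ (∑ i ∈ Finset.range j, α ^ (n * i)) * c ^ (n * j) := by
  induction j with
  | zero => simp
  | succ j ih =>
    have := h.pow_mul_zpow 1 (n * j)
    rw [zpow_one, one_mul] at this
    rw [pow_succ, ih, Finset.sum_range_succ, zpow_add, mul_assoc, ← mul_assoc _ b, this,
      Nat.mul_succ, pow_add]
    simp only [mul_assoc]

/-- Conjugating `b` by `a ^ n` gives `b * c ^ n` times a central element; the formula is the `n`-th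
power of this. -/
theorem pow_mul_pow_of_central (h : IsMacdonaldTriple α a b c) {n : ℕ}
    (hn : a ^ (powSum α n - n) ∈ center H) :
    a ^ n * b ^ n = (a ^ (powSum α n - n)) ^ n *
      (b ^ (∑ i ∈ Finset.range n, α ^ (n * i)) * c ^ (n * n)) * a ^ n := by
  set w := a ^ (powSum α n - n) with hw
  have h1 : a ^ n * b * (a ^ n)⁻¹ = w * (b * c ^ n) := by
    rw [h.pow_mul_eq, mul_inv_eq_iff_eq_mul, ← mem_center_iff.1 hn, hw, zpow_sub, zpow_natCast]
    group
  have h2 : Commute w (b * c ^ n) := (mem_center_iff.1 hn _).symm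
  rw [← h.mul_pow_pow n n, ← h2.mul_pow, ← h1, conj_pow]
  group

/-- Comparing `pow_mul_pow_of_central` with its mirror image under `symm` makes a `c`-conjugate of a
power of `a` equal to a central element times a power of `b`. -/
theorem commute_zpow_of_central (h : IsMacdonaldTriple α a b c) {n : ℕ}
    (hn : (powSum α n - n) ∈ centralExponents a b) :
    Commute (a ^ (n * α ^ (n * n) - ∑ i ∈ Finset.range n, α ^ (n * i))) b := by
  set S := ∑ i ∈ Finset.range n, α ^ (n * i) with hS
  set C := c ^ (n * n) with hC
  set N := α ^ (n * n) with hN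
  have e1 := h.pow_mul_pow_of_central hn.1
  have e2 := h.symm.pow_mul_pow_of_central hn.2
  rw [inv_pow, ← hS, ← hC] at e2
  rw [← hS, ← hC] at e1
  set u := (a ^ (powSum α n - n)) ^ n with hu
  set v := (b ^ (powSum α n - n)) ^ n with hv
  have huc : u ∈ center H := pow_mem hn.1 n
  have hvc : v ∈ center H := pow_mem hn.2 n
  have f1 : C⁻¹ * (a ^ n)⁻¹ = a ^ (-(n * N)) * C⁻¹ := by
    have := h.zpow_mul_pow n (n * n)
    rw [zpow_natCast, ← hC, ← hN] at this
    rw [← mul_inv_rev, this, mul_inv_rev, zpow_neg]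
  have f2 : b ^ n = C⁻¹ * b ^ (n * N) * C := by
    have := h.pow_mul_zpow n (n * n)
    rw [zpow_natCast, ← hC, ← hN] at this
    rw [mul_assoc, ← this]; group
  have f3 : b ^ n = v * u * (a ^ (S - n * N) * (C⁻¹ * b ^ S * C)) := by
    calc b ^ n = b ^ n * a ^ n * (a ^ n)⁻¹ := by group
      _ = v * (a ^ S * (C⁻¹ * (a ^ n)⁻¹ * (a ^ n * b ^ n) * (a ^ n)⁻¹)) := by rw [e2]; group
      _ = v * (a ^ S * a ^ (-(n * N)) * C⁻¹ * u * (b ^ S * C)) := by rw [f1, e1]; group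
      _ = v * (u * (a ^ S * a ^ (-(n * N)) * C⁻¹) * (b ^ S * C)) := by
        rw [mem_center_iff.1 huc]
      _ = _ := by rw [← zpow_add, ← sub_eq_add_neg]; simp only [mul_assoc]
  have f4 : C * a ^ (n * N - S) * C⁻¹ = v * u * b ^ (S - n * N) := by
    have hvu : v * u ∈ center H := mul_mem hvc huc
    have g1 : a ^ (n * N - S) * b ^ n = v * u * (C⁻¹ * b ^ S * C) := by
      rw [f3, ← mul_assoc, mem_center_iff.1 hvu, mul_assoc, ← mul_assoc (a ^ (n * N - S)),
        ← zpow_add]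
      simp
    have g2 : a ^ (n * N - S) = v * u * (C⁻¹ * b ^ (S - n * N) * C) := by
      rw [← mul_right_cancel_iff (a := b ^ n), g1, zpow_sub, f2]; group
    rw [g2, ← mul_assoc, mem_center_iff.1 hvu]; group
  refine h.commute_of_conj (k := n * n) ?_
  rw [← hC, f4]
  exact Commute.mul_left (mem_center_iff.1 (mul_mem hvc huc) b).symm
    ((Commute.refl b).zpow_left _)

theorem mem_centralExponents_of_central (h : IsMacdonaldTriple α a b c)
    (hg : closure ({a, b} : Set H) = ⊤) {n : ℕ} (hn : (powSum α n - n) ∈ centralExponents a b) :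
    n * α ^ (n * n) - ∑ i ∈ Finset.range n, α ^ (n * i) ∈ centralExponents a b :=
  ⟨mem_center_of_closure_pair hg ((Commute.refl a).zpow_left _) (h.commute_zpow_of_central hn),
   mem_center_of_closure_pair hg (h.symm.commute_zpow_of_central ⟨hn.2, hn.1⟩)
    ((Commute.refl b).zpow_left _)⟩

/-- If `a ^ x` and `b ^ x` lie in the `i`-th term of the upper central series, then `a ^ y` and
`b ^ y` lie in the `(i + 2)`-nd term for suitable `y`. -/
theorem mem_upperCentralSeries_add_two (h : IsMacdonaldTriple α a b c)
    (hg : closure ({a, b} : Set H) = ⊤) {i : ℕ} {x : ℤ} {y : ℕ}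
    (ha : a ^ x ∈ Subgroup.upperCentralSeries H i) (hb : b ^ x ∈ Subgroup.upperCentralSeries H i)
    (h1 : x ∣ α ^ y - 1) (h2 : x ∣ powSum α y - y) :
    a ^ y ∈ Subgroup.upperCentralSeries H (i + 2) ∧ b ^ y ∈ Subgroup.upperCentralSeries H (i + 2) := by
  have step : ∀ (j : ℕ) (g : H), (g * a)⁻¹ * (a * g) ∈ Subgroup.upperCentralSeries H j →
      (g * b)⁻¹ * (b * g) ∈ Subgroup.upperCentralSeries H j → g ∈ Subgroup.upperCentralSeries H (j + 1) := by
    intro j g hga hgb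
    let π := QuotientGroup.mk' (Subgroup.upperCentralSeries H j)
    have hc : ∀ u v : H, u⁻¹ * v ∈ Subgroup.upperCentralSeries H j ↔ π u = π v :=
      fun u v => (QuotientGroup.eq (s := Subgroup.upperCentralSeries H j)).symm
    have hg' : closure ({π a, π b} : Set (H ⧸ Subgroup.upperCentralSeries H j)) = ⊤ := by
      have := congrArg (Subgroup.map π) hg
      rwa [MonoidHom.map_closure, Set.image_pair, Subgroup.map_top_of_surjective _
        (QuotientGroup.mk'_surjective _)] at this
    have : π g ∈ center _ := mem_center_of_closure_pair hg'
      (by rw [hc, map_mul, map_mul] at hga; exact hga)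
      (by rw [hc, map_mul, map_mul] at hgb; exact hgb)
    rw [Subgroup.mem_upperCentralSeries_succ_iff]
    intro z
    have hz := mem_center_iff.1 this (π z)
    rw [← (QuotientGroup.ker_mk' (Subgroup.upperCentralSeries H j)), MonoidHom.mem_ker]
    change π _ = 1
    rw [commutatorElement_def, map_mul, map_mul, map_mul, ← hz, map_inv, map_inv]; group
  have key : ∀ {α : ℤ} {a b c : H}, IsMacdonaldTriple α a b c → a ^ x ∈ Subgroup.upperCentralSeries H i →
      x ∣ α ^ y - 1 → (c ^ y * a)⁻¹ * (a * c ^ y) ∈ Subgroup.upperCentralSeries H i := by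
    intro α a b c h ha h1
    obtain ⟨k, hk⟩ := h1
    have := h.zpow_mul_pow 1 y
    rw [zpow_one, one_mul] at this
    rw [this, show α ^ y = 1 + x * k by linear_combination hk, zpow_add, zpow_one, zpow_mul]
    convert zpow_mem ha k using 1
    group
  -- Modulo the `i`-th term, `c ^ y` acts on `a` and `b` by the exponent `α ^ y ≡ 1`, hence
  -- trivially.
  have hcy : c ^ y ∈ Subgroup.upperCentralSeries H (i + 1) := by
    have h3 := key h ha h1
    have h4 := key h.symm hb h1
    refine step i _ h3 ?_
    have h5 : (b * c ^ y)⁻¹ * (c ^ y * b) ∈ Subgroup.upperCentralSeries H i := by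
      have := (inferInstance : (Subgroup.upperCentralSeries H i).Normal).conj_mem _ h4 (c ^ y)⁻¹
      convert this using 1
      group
    simpa using inv_mem h5
  have mono : Subgroup.upperCentralSeries H i ≤ Subgroup.upperCentralSeries H (i + 1) :=
    Subgroup.upperCentralSeries_mono H (Nat.le_succ i)
  have key3 : ∀ {a b c : H}, IsMacdonaldTriple α a b c → a ^ x ∈ Subgroup.upperCentralSeries H i →
      c ^ y ∈ Subgroup.upperCentralSeries H (i + 1) →
      (b * a ^ y)⁻¹ * (a ^ y * b) ∈ Subgroup.upperCentralSeries H (i + 1) := by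
    intro a b c h ha hc
    obtain ⟨k, hk⟩ := h2
    have h6 : (a ^ y)⁻¹ * c ^ y * a ^ y * (a ^ x) ^ k ∈ Subgroup.upperCentralSeries H (i + 1) := by
      refine mul_mem ?_ (zpow_mem (mono ha) k)
      have := (inferInstance : (Subgroup.upperCentralSeries H (i + 1)).Normal).conj_mem _ hc (a ^ y)⁻¹
      simpa using this
    rw [h.pow_mul_eq, show powSum α y = y + x * k by linear_combination hk, zpow_add, zpow_mul,
      zpow_natCast]
    convert h6 using 1
    group
  have self : ∀ z : H, (z ^ y * z)⁻¹ * (z * z ^ y) = 1 := by intro z; group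
  refine ⟨step (i + 1) _ ?_ ?_, step (i + 1) _ ?_ ?_⟩
  · rw [self]; exact one_mem _
  · simpa using inv_mem (key3 h ha hcy)
  · simpa using inv_mem (key3 h.symm hb (by rw [inv_pow]; exact inv_mem hcy))
  · rw [self]; exact one_mem _

end IsMacdonaldTriple

/-! ### Finiteness and prime divisors of the orders of the generators. -/

theorem exists_mul_coprime (t : ℕ) {K : ℕ} (hK : 0 < K) :
    ∃ L R w : ℕ, K = L * R ∧ L ∣ t ^ w ∧ Nat.Coprime R t := by
  induction K using Nat.strong_induction_on with
  | _ K ih =>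
    by_cases h : Nat.Coprime K t
    · exact ⟨1, K, 0, by simp, by simp, h⟩
    · obtain ⟨K', hK'⟩ := Nat.gcd_dvd_left K t
      have hpos : 0 < Nat.gcd K t := Nat.gcd_pos_of_pos_left _ hK
      have hg : 1 < Nat.gcd K t := lt_of_le_of_ne hpos (Ne.symm h)
      have hK'0 : 0 < K' := Nat.pos_of_ne_zero (by rintro rfl; simp at hK'; omega)
      obtain ⟨L, R, w, h1, h2, h3⟩ := ih K' (by rw [hK']; nlinarith) hK'0
      refine ⟨Nat.gcd K t * L, R, w + 1, by rw [mul_assoc, ← h1]; exact hK', ?_, h3⟩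
      rw [pow_succ']
      exact mul_dvd_mul (Nat.gcd_dvd_right K t) h2

theorem geom_sum_range_mul (β : ℤ) (m r : ℕ) :
    ∑ i ∈ Finset.range (m * r), β ^ i =
      (∑ i ∈ Finset.range m, β ^ i) * ∑ j ∈ Finset.range r, (β ^ m) ^ j := by
  induction r with
  | zero => simp
  | succ r ihr =>
    rw [Nat.mul_succ, Finset.sum_range_add, ihr, Finset.sum_range_succ, mul_add]
    congr 1
    rw [Finset.sum_mul]
    refine Finset.sum_congr rfl fun i _ => ?_
    rw [pow_add, pow_mul, mul_comm]

theorem pow_dvd_geom_sum {q : ℕ} {β : ℤ} (h : (q : ℤ) ∣ β - 1) (k : ℕ) :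
    (q : ℤ) ^ k ∣ ∑ i ∈ Finset.range (q ^ k), β ^ i := by
  induction k with
  | zero => simp
  | succ k ih =>
    rw [pow_succ q, geom_sum_range_mul, pow_succ]
    refine mul_dvd_mul ih ?_
    have h2 : ∑ j ∈ Finset.range q, (β ^ q ^ k) ^ j ≡ ∑ j ∈ Finset.range q, 1 [ZMOD q] := by
      refine Int.ModEq.sum fun j _ => ?_
      have : β ≡ 1 [ZMOD q] := (Int.modEq_iff_dvd.2 h).symm
      simpa using (this.pow (q ^ k)).pow j
    rw [Int.modEq_iff_dvd] at h2
    simpa using h2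

theorem pow_succ_dvd_pow_sub_one {q : ℕ} {β : ℤ} (h : (q : ℤ) ∣ β - 1) (k : ℕ) :
    (q : ℤ) ^ (k + 1) ∣ β ^ q ^ k - 1 := by
  rw [← geom_sum_mul, pow_succ]
  exact mul_dvd_mul (pow_dvd_geom_sum h k) h

namespace IsMacdonaldTriple

variable {H : Type*} [Group H] {α : ℤ} {a b c : H}

/-- Only the class of `α` modulo a common exponent matters; this reduces arbitrary `α ≠ 1` to `α >
1`. -/
theorem of_zpow_eq_one (h : IsMacdonaldTriple α a b c) {K : ℤ} (ha : a ^ K = 1) (hb : b ^ K = 1)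
    (j : ℤ) : IsMacdonaldTriple (α + K * j) a b c where
  comm := h.comm
  left := by rw [zpow_add, zpow_mul, ha, one_zpow, mul_one]; exact h.left
  right := by rw [zpow_add, zpow_mul, hb, one_zpow, mul_one]; exact h.right

end IsMacdonaldTriple

theorem macdonald_exponent_pos {t : ℕ} :
    (((t : ℤ) + 1) ^ (t + 2) - powSum (t + 1) (t + 1)) * t =
      (t + 1) * ((t + 1) ^ (t + 1) * (t - 1) + 1) := by
  have := powSum_mul ((t : ℤ) + 1) (t + 1)
  rw [add_sub_cancel_right] at this
  rw [sub_mul, this]; ring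

namespace IsMacdonaldTriple

variable {H : Type*} [Group H] {α : ℤ} {a b c : H}

theorem exists_ne_zero_mem_centralExponents (h : IsMacdonaldTriple α a b c)
    (hg : closure ({a, b} : Set H) = ⊤) (hα : α ≠ 1) :
    ∃ x : ℤ, x ≠ 0 ∧ x ∈ centralExponents a b := by
  rcases lt_or_gt_of_ne hα with h1 | h1
  · obtain ⟨n, hn⟩ : ∃ n : ℕ, α = -(n : ℤ) := ⟨(-α).toNat, by omega⟩
    subst hn
    rcases Nat.eq_zero_or_pos n with rfl | hn0
    · refine ⟨1, one_ne_zero, ?_⟩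
      have ha : a = 1 := by simpa using h.left
      have hb : b = 1 := by simpa using h.right
      subst ha hb
      exact ⟨by simp [one_mem], by simp [one_mem]⟩
    -- At `α = -2` the exponent of `commute_zpow_of_neg` vanishes. There `powSum α 2 = 2`, so the
    -- second source applies with the trivial central exponent `0` and yields `2 * 16 - 5 = 27`.
    by_cases hn2 : n = 2
    · subst hn2
      refine ⟨_, ?_, h.mem_centralExponents_of_central hg (n := 2) ?_⟩
      · norm_num [Finset.sum_range_succ]
      · simp [powSum, Finset.sum_range_succ, zero_mem]
    refine ⟨_, ?_, h.mem_centralExponents_of_neg hg⟩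
    have hs := powSum_mul (-(n : ℤ)) n
    intro h0
    have h2 : powSum (-(n : ℤ)) n = n := by
      rcases mul_eq_zero.1 h0 with h0 | h0
      · simp at h0; omega
      · linarith
    rw [h2] at hs
    have h3 : (-(n : ℤ)) ^ n = n + 2 := by
      have hn' : (n : ℤ) ≠ 0 := by exact_mod_cast hn0.ne'
      apply mul_left_cancel₀ hn'
      linear_combination hs
    rcases (by omega : n = 1 ∨ 3 ≤ n) with rfl | h3n
    · norm_num at h3
    · have h4 : (n : ℤ) ^ n = n + 2 := by
        have := congrArg abs h3
        rwa [abs_pow, abs_neg, Nat.abs_cast, abs_of_nonneg (by positivity)] at this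
      have h5 : n ^ 3 ≤ n ^ n := Nat.pow_le_pow_right hn0 h3n
      have h6 : n ^ n = n + 2 := by exact_mod_cast h4
      nlinarith [sq_nonneg n]
  · obtain ⟨t, ht⟩ : ∃ t : ℕ, α = (t : ℤ) + 1 := ⟨(α - 1).toNat, by omega⟩
    subst ht
    refine ⟨_, ?_, h.mem_centralExponents_of_pos hg⟩
    intro h0
    have := macdonald_exponent_pos (t := t)
    rw [h0, zero_mul] at this
    have ht : (1 : ℤ) ≤ t := by omega
    have : (0 : ℤ) < (t + 1) * ((t + 1) ^ (t + 1) * (t - 1) + 1) := by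
      have : (0 : ℤ) ≤ t - 1 := by omega
      positivity
    omega

theorem exists_pow_eq_one (h : IsMacdonaldTriple α a b c)
    (hg : closure ({a, b} : Set H) = ⊤) (hα : α ≠ 1) :
    ∃ K : ℕ, 0 < K ∧ a ^ K = 1 ∧ b ^ K = 1 := by
  obtain ⟨x, hx0, hx⟩ := h.exists_ne_zero_mem_centralExponents hg hα
  have hne : x * (α - 1) ≠ 0 := mul_ne_zero hx0 (sub_ne_zero.2 hα)
  have key : ∀ g : H, g ^ (x * (α - 1)) = 1 → g ^ (x * (α - 1)).natAbs = 1 := by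
    intro g hgx
    rw [← zpow_natCast, Int.natCast_natAbs]
    rcases abs_choice (x * (α - 1)) with h1 | h1 <;> rw [h1]
    · exact hgx
    · rw [zpow_neg, hgx, inv_one]
  exact ⟨_, Int.natAbs_pos.2 hne, key a (h.zpow_mul_sub_one hx.1),
    key b (h.symm.zpow_mul_sub_one hx.2)⟩

/-- `a ^ m` is conjugate to `a`, so the two have the same order. -/
theorem coprime_orderOf {m : ℕ} (h : IsMacdonaldTriple (m : ℤ) a b c) (ha : IsOfFinOrder a) :
    Nat.Coprime (orderOf a) m := by
  have h1 : a ^ m = c⁻¹ * a * c⁻¹⁻¹ := by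
    rw [← zpow_natCast, mul_assoc, inv_inv, h.left]; group
  have h2 : orderOf (a ^ m) = orderOf a := by
    rw [h1]; exact orderOf_injective (MulAut.conj c⁻¹).toMonoidHom (MulAut.conj c⁻¹).injective a
  rw [ha.orderOf_pow] at h2
  have := ha.orderOf_pos
  rcases Nat.div_eq_self.1 h2 with h3 | h3
  · omega
  · exact h3

/-- The hypotheses make `c ^ n` commute with `a` and `b`. The `t`-th power of the conjugation
formula for `a ^ n` loses its `a`-part, leaving `a ^ (n * t) = c ^ (n * t)`; this commutes with `c`,
which costs one more factor `t`. -/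
theorem pow_mul_sq_eq_one {t n : ℕ} (h : IsMacdonaldTriple ((t : ℤ) + 1) a b c)
    (ha : a ^ (((t : ℤ) + 1) ^ n - 1) = 1) (hb : b ^ (((t : ℤ) + 1) ^ n - 1) = 1) :
    a ^ (n * t ^ 2) = 1 := by
  have hca : Commute (c ^ n) a := by
    have := h.zpow_mul_pow 1 n
    rw [one_mul, ← sub_add_cancel (((t : ℤ) + 1) ^ n) 1, zpow_add, ha, one_mul, zpow_one] at this
    exact this.symm
  have hcb : Commute (c ^ n) b := by
    have := h.pow_mul_zpow 1 n
    rw [one_mul, ← sub_add_cancel (((t : ℤ) + 1) ^ n) 1, zpow_add, hb, one_mul, zpow_one] at this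
    exact this
  set s := powSum ((t : ℤ) + 1) n with hs
  have h1 : a ^ (s * t) = 1 := by
    have := powSum_mul ((t : ℤ) + 1) n
    rw [add_sub_cancel_right, ← hs] at this
    rw [this, mul_comm, zpow_mul, ha, one_zpow]
  have h2 : a ^ (n * t) * b = b * c ^ (n * t) := by
    have e : b⁻¹ * a ^ n * b⁻¹⁻¹ = c ^ n * a ^ s := by
      rw [inv_inv, mul_assoc, h.pow_mul_eq, inv_mul_cancel_left]
    have := congrArg (· ^ t) e
    simp only [conj_pow] at this
    rw [(hca.zpow_right s).mul_pow, ← zpow_natCast (a ^ s), ← zpow_mul, h1, mul_one, ← pow_mul,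
      ← pow_mul, inv_inv, mul_assoc, inv_mul_eq_iff_eq_mul] at this
    exact this
  have h3 : a ^ (n * t) = c ^ (n * t) := by
    have : Commute (c ^ (n * t)) b := by rw [pow_mul]; exact hcb.pow_left t
    rw [← this.eq] at h2
    exact mul_right_cancel h2
  have h4 : Commute (a ^ (n * t)) c := by rw [h3]; exact (Commute.refl c).pow_left _
  have h5 := h.zpow_mul_pow ((n * t : ℕ) : ℤ) 1
  rw [pow_one, zpow_natCast, h4.eq, pow_one, mul_add, zpow_add, mul_one, zpow_natCast] at h5
  have h6 := mul_left_cancel h5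
  have h7 : a ^ (((n * t : ℕ) : ℤ) * t) = 1 := by simpa using h6
  rw [pow_two, ← mul_assoc, ← zpow_natCast]
  exact_mod_cast h7

/-- The orders of `a` and `b` have only prime factors dividing `α - 1`. -/
theorem exists_pow_pow_eq_one {t : ℕ} (h : IsMacdonaldTriple ((t : ℤ) + 1) a b c)
    {K : ℕ} (hK : 0 < K) (ha : a ^ K = 1) (hb : b ^ K = 1) :
    ∃ w : ℕ, a ^ t ^ w = 1 ∧ b ^ t ^ w = 1 := by
  have hfa : IsOfFinOrder a := isOfFinOrder_iff_pow_eq_one.2 ⟨K, hK, ha⟩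
  have hfb : IsOfFinOrder b := isOfFinOrder_iff_pow_eq_one.2 ⟨K, hK, hb⟩
  set N := Nat.lcm (orderOf a) (orderOf b) with hN
  have hNpos : 0 < N := Nat.lcm_pos hfa.orderOf_pos hfb.orderOf_pos
  have hcop : Nat.Coprime (t + 1) N := by
    have h' : IsMacdonaldTriple ((t + 1 : ℕ) : ℤ) a b c := by exact_mod_cast h
    have := (h'.coprime_orderOf hfa).mul_left (h'.symm.coprime_orderOf hfb)
    exact (Nat.Coprime.coprime_dvd_left (Nat.lcm_dvd_mul _ _) this).symm
  obtain ⟨L, R, w, hLR, hL, hR⟩ := exists_mul_coprime t hNpos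
  have hRpos : 0 < R := Nat.pos_of_ne_zero (by rintro rfl; omega)
  -- Chosen so that `(t + 1) ^ n ≡ 1` modulo `L` (lifting the exponent) and modulo `R` (Euler). Then
  -- `N ∣ n * t ^ 2` forces `R ∣ φ(R)`, so `R = 1`.
  set n := t ^ w * Nat.totient R with hn
  have hdvd : (N : ℤ) ∣ ((t : ℤ) + 1) ^ n - 1 := by
    have d1 : (L : ℤ) ∣ ((t : ℤ) + 1) ^ n - 1 := by
      have e1 : (t : ℤ) ^ (w + 1) ∣ ((t : ℤ) + 1) ^ t ^ w - 1 :=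
        pow_succ_dvd_pow_sub_one (by simp) w
      have e2 : (L : ℤ) ∣ (t : ℤ) ^ w := by exact_mod_cast hL
      have e3 : ((t : ℤ) + 1) ^ t ^ w - 1 ∣ ((t : ℤ) + 1) ^ n - 1 := by
        rw [hn, pow_mul]
        exact sub_one_dvd_pow_sub_one _ _
      exact (e2.trans (pow_dvd_pow _ (Nat.le_succ w))).trans (e1.trans e3)
    have d2 : (R : ℤ) ∣ ((t : ℤ) + 1) ^ n - 1 := by
      have e1 : Nat.Coprime (t + 1) R := Nat.Coprime.coprime_dvd_right ⟨L, by rw [hLR, mul_comm]⟩ hcop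
      have e2 := (Nat.ModEq.pow_totient e1).pow (t ^ w)
      rw [← pow_mul, one_pow, mul_comm, ← hn] at e2
      have := (Nat.modEq_iff_dvd.1 e2.symm)
      push_cast at this
      exact this
    have e4 : IsCoprime (L : ℤ) R := by
      rw [Nat.isCoprime_iff_coprime]
      exact Nat.Coprime.coprime_dvd_left hL (hR.symm.pow_left w)
    rw [hLR]; push_cast
    exact e4.mul_dvd d1 d2
  have hone : ∀ g : H, orderOf g ∣ N → g ^ (((t : ℤ) + 1) ^ n - 1) = 1 := fun g hgN =>
    orderOf_dvd_iff_zpow_eq_one.1 ((Int.natCast_dvd_natCast.2 hgN).trans hdvd)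
  have ha1 := hone a (Nat.dvd_lcm_left _ _)
  have hb1 := hone b (Nat.dvd_lcm_right _ _)
  have hNn : N ∣ n * t ^ 2 := Nat.lcm_dvd (orderOf_dvd_of_pow_eq_one (h.pow_mul_sq_eq_one ha1 hb1))
    (orderOf_dvd_of_pow_eq_one (h.symm.pow_mul_sq_eq_one hb1 ha1))
  have hRt : R ∣ Nat.totient R := by
    have e1 : R ∣ t ^ (w + 2) * Nat.totient R :=
      (Dvd.intro_left L hLR.symm).trans (hNn.trans (by rw [hn]; exact ⟨1, by ring⟩))
    exact (hR.pow_right (w + 2)).dvd_of_dvd_mul_left e1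
  have hR1 : R = 1 := by
    by_contra hne
    have h1 := Nat.le_of_dvd (Nat.totient_pos.2 hRpos) hRt
    have h2 := Nat.totient_lt R (by omega)
    omega
  have hNt : N ∣ t ^ w := by rw [hLR, hR1, mul_one]; exact hL
  exact ⟨w, orderOf_dvd_iff_pow_eq_one.1 ((Nat.dvd_lcm_left _ _).trans hNt),
    orderOf_dvd_iff_pow_eq_one.1 ((Nat.dvd_lcm_right _ _).trans hNt)⟩

end IsMacdonaldTriple

/-! ### Arithmetic of the central exponents. -/

theorem four_term_binomial (t : ℤ) (n : ℕ) : ∃ W : ℤ, 24 * (t + 1) ^ n =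
    24 + 24 * n * t + 12 * (n * (n - 1)) * t ^ 2 + 4 * (n * (n - 1) * (n - 2)) * t ^ 3 +
      n * (n - 1) * (n - 2) * (n - 3) * t ^ 4 + 24 * t ^ 5 * W := by
  induction n with
  | zero => exact ⟨0, by simp⟩
  | succ n ih =>
    obtain ⟨W, hW⟩ := ih
    have h4 : ∃ q : ℤ, (n : ℤ) * (n - 1) * (n - 2) * (n - 3) = 24 * q := by
      rcases (by omega : n = 0 ∨ n = 1 ∨ n = 2 ∨ 3 ≤ n) with rfl | rfl | rfl | h3
      · exact ⟨0, by simp⟩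
      · exact ⟨0, by simp⟩
      · exact ⟨0, by simp⟩
      · obtain ⟨m, rfl⟩ := Nat.exists_eq_add_of_le' h3
        have h := Nat.descFactorial_eq_factorial_mul_choose (m + 3) 4
        refine ⟨((m + 3).choose 4 : ℤ), ?_⟩
        have h' : (((m + 3).descFactorial 4 : ℕ) : ℤ) = 24 * ((m + 3).choose 4 : ℤ) := by
          rw [h]; push_cast; norm_num [Nat.factorial]
        rw [← h']
        simp [Nat.descFactorial_succ]
        ring
    obtain ⟨q, hq⟩ := h4
    refine ⟨W * (t + 1) + q, ?_⟩
    rw [pow_succ, ← mul_assoc, hW]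
    push_cast
    linear_combination t ^ 5 * hq

/-- The exponent of the central power of `a` for `α = t + 1`, up to the factor `24`. -/
theorem exponent_expansion {t : ℕ} (ht : 0 < t) : ∃ W : ℤ,
    24 * (((t : ℤ) + 1) ^ (t + 2) - powSum (t + 1) (t + 1)) = ((t : ℤ) + 1) * (t ^ 2 *
      (12 + 4 * t + 6 * t ^ 2 - t ^ 3 + 5 * t ^ 4 - 3 * t ^ 5 + t ^ 6 + 24 * t ^ 2 * W)) := by
  obtain ⟨W, hW⟩ := four_term_binomial t (t + 1)
  refine ⟨W * (t - 1), ?_⟩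
  have ht' : (t : ℤ) ≠ 0 := by exact_mod_cast ht.ne'
  apply mul_right_cancel₀ ht'
  rw [mul_assoc, macdonald_exponent_pos]
  push_cast at hW
  linear_combination ((t : ℤ) + 1) * (t - 1) * hW

/-- The divisibility properties shared by `D = t ^ 2` for odd `t` and `D = t ^ 2 / 2` for even `t`. -/
structure IsHalfSq (t D : ℤ) : Prop where
  dvd_sq : D ∣ t ^ 2
  two_mul_dvd : 2 * D ∣ t ^ 2 * (t + 1)
  sq_dvd : t ^ 2 ∣ 2 * D

theorem IsHalfSq.of_odd {t : ℤ} (h : Odd t) : IsHalfSq t (t ^ 2) where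
  dvd_sq := dvd_rfl
  two_mul_dvd := by
    rw [mul_comm]
    exact mul_dvd_mul_left _ h.add_one.two_dvd
  sq_dvd := Dvd.intro_left _ rfl

theorem IsHalfSq.of_even {t D : ℤ} (h : t ^ 2 = 2 * D) : IsHalfSq t D where
  dvd_sq := ⟨2, by rw [h]; ring⟩
  two_mul_dvd := ⟨t + 1, by rw [h]⟩
  sq_dvd := by rw [h]

/-- For odd `t` the cofactor is `12` modulo `t`; for `t = 2 * v` it is odd and `3` modulo `v`. -/
theorem exists_factor_of_not_three_dvd {t : ℕ} (ht : 0 < t) (h3 : ¬ 3 ∣ t) : ∃ D V k : ℤ,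
    k * (((t : ℤ) + 1) ^ (t + 2) - powSum (t + 1) (t + 1)) = ((t : ℤ) + 1) * (D * V) ∧
      IsHalfSq t D ∧ IsCoprime V t := by
  obtain ⟨W, hW⟩ := exponent_expansion ht
  have hc3 : IsCoprime (3 : ℤ) t := by
    exact_mod_cast Nat.isCoprime_iff_coprime.2 ((Nat.Prime.coprime_iff_not_dvd Nat.prime_three).2 h3)
  rcases Nat.even_or_odd' t with ⟨v, rfl | rfl⟩
  · push_cast at hW hc3 ⊢
    refine ⟨2 * v ^ 2, 3 + 2 * v + 6 * v ^ 2 - 2 * v ^ 3 + 20 * v ^ 4 - 24 * v ^ 5 + 16 * v ^ 6 +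
      24 * v ^ 2 * W, 3,
      mul_left_cancel₀ (by norm_num : (8 : ℤ) ≠ 0) (by linear_combination hW), .of_even (by ring), ?_⟩
    refine IsCoprime.mul_right ?_ ?_
    · exact ⟨1, -(1 + v + 3 * v ^ 2 - v ^ 3 + 10 * v ^ 4 - 12 * v ^ 5 + 8 * v ^ 6 +
        12 * v ^ 2 * W), by ring⟩
    · have := (hc3.of_mul_right_right).add_mul_left_left (2 + 6 * v - 2 * v ^ 2 + 20 * v ^ 3 -
        24 * v ^ 4 + 16 * v ^ 5 + 24 * v * W)
      ring_nf at this ⊢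
      exact this
  · refine ⟨_, _, 24, hW, .of_odd ⟨v, by push_cast; rfl⟩, ?_⟩
    set s : ℤ := ((2 * v + 1 : ℕ) : ℤ) with hs
    have hc2 : IsCoprime (2 : ℤ) s := ⟨-v, 1, by rw [hs]; push_cast; ring⟩
    have := ((hc2.mul_left hc2).mul_left hc3).add_mul_left_left (4 + 6 * s - s ^ 2 + 5 * s ^ 3 -
        3 * s ^ 4 + s ^ 5 + 24 * s * W)
    ring_nf at this ⊢
    exact this

/-- Modulo `9` the cofactor `V` is `u + 1` or `4 * (u + 1)`, so `9 ∣ V` only in the exceptional case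
`α ≡ -2` mod `27`. -/
theorem exists_factor_of_three_dvd {u : ℕ} (hu : 0 < u) : ∃ D V k : ℤ,
    k * ((((3 * u : ℕ) : ℤ) + 1) ^ (3 * u + 2) - powSum ((3 * u : ℕ) + 1) (3 * u + 1)) =
      (((3 * u : ℕ) : ℤ) + 1) * (D * V) ∧
      IsHalfSq ((3 * u : ℕ) : ℤ) D ∧ (9 ∣ V → (9 : ℤ) ∣ u + 1) ∧
      ∀ x : ℤ, x ∣ V → ¬ 3 ∣ x → IsCoprime x ((3 * u : ℕ) : ℤ) := by
  obtain ⟨W, hW⟩ := exponent_expansion (t := 3 * u) (by omega)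
  have hp3 : ∀ x : ℤ, ¬ 3 ∣ x → IsCoprime x 3 := fun x hx =>
    ((Int.prime_three.coprime_iff_not_dvd).2 hx).symm
  rcases Nat.even_or_odd' u with ⟨v, rfl | rfl⟩
  · push_cast at hW ⊢
    set X : ℤ := 2 - 2 * v + 60 * v ^ 2 - 216 * v ^ 3 + 432 * v ^ 4 + 8 * W with hX
    refine ⟨18 * v ^ 2, 1 + 2 * v + 9 * v ^ 2 * X, 1,
      mul_left_cancel₀ (by norm_num : (24 : ℤ) ≠ 0) (by rw [hX]; linear_combination hW), .of_even (by ring), ?_, ?_⟩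
    · rintro ⟨y, hy⟩
      exact ⟨y - v ^ 2 * X, by linear_combination hy⟩
    · intro x hx hx3
      refine IsCoprime.mul_right (hp3 x hx3) ?_
      refine IsCoprime.of_isCoprime_of_dvd_left (IsCoprime.mul_right ?_ ?_) hx
      · exact ⟨1, -(v + 9 * v ^ 2 * (1 - v + 30 * v ^ 2 - 108 * v ^ 3 + 216 * v ^ 4 + 4 * W)),
          by rw [hX]; ring⟩
      · exact ⟨1, -(2 + 9 * v * X), by ring⟩
  · have hodd : Odd ((3 * (2 * v + 1) : ℕ) : ℤ) := ⟨3 * v + 1, by push_cast; ring⟩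
    have hc2 : IsCoprime (2 : ℤ) ((2 * v + 1 : ℕ) : ℤ) := ⟨-v, 1, by push_cast; ring⟩
    set s : ℤ := ((2 * v + 1 : ℕ) : ℤ) with hs
    have hcast : ((3 * (2 * v + 1) : ℕ) : ℤ) = 3 * s := by rw [hs]; push_cast; ring
    rw [hcast] at hW hodd ⊢
    set X : ℤ := 2 - s + 15 * s ^ 2 - 27 * s ^ 3 + 27 * s ^ 4 + 8 * W with hX
    refine ⟨(3 * s) ^ 2, 4 * (1 + s) + 9 * s ^ 2 * X, 8,
      mul_left_cancel₀ (by norm_num : (3 : ℤ) ≠ 0) (by rw [hX]; linear_combination hW), .of_odd hodd, ?_, ?_⟩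
    · rintro ⟨y, hy⟩
      exact ⟨-2 * y + s + 1 + 2 * s ^ 2 * X, by linear_combination -2 * hy⟩
    · intro x hx hx3
      refine IsCoprime.mul_right (hp3 x hx3) ?_
      refine IsCoprime.of_isCoprime_of_dvd_left ?_ hx
      have := (hc2.mul_left hc2).add_mul_left_left (4 + 9 * s * X)
      rwa [show (2 * 2 : ℤ) + s * (4 + 9 * s * X) = 4 * (1 + s) + 9 * s ^ 2 * X by ring] at this

theorem pow_three_pow_sub_one {t : ℤ} (ht : 27 ∣ t + 3) (r : ℕ) :
    ∃ g : ℤ, (t + 1) ^ 3 ^ (r + 1) - 1 = 3 ^ (r + 1) * t * (1 + 9 * g) := by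
  obtain ⟨j, hj⟩ := ht
  obtain rfl : t = 27 * j - 3 := by linear_combination hj
  induction r with
  | zero => exact ⟨-3 * j + 27 * j ^ 2, by ring⟩
  | succ r ih =>
    obtain ⟨g, hg⟩ := ih
    set y : ℤ := 3 ^ r * (9 * j - 1) * (1 + 9 * g) with hy
    have hY : (27 * j - 3 + 1) ^ 3 ^ (r + 1) = 1 + 9 * y := by
      rw [hy]; linear_combination hg
    refine ⟨g + (1 + 9 * g) * (y + 3 * y ^ 2), ?_⟩
    rw [pow_succ 3 (r + 1), pow_mul, hY]
    have : 9 * y = 3 ^ (r + 1) * (27 * j - 3) * (1 + 9 * g) := by rw [hy]; ring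
    linear_combination (3 + 27 * y + 81 * y ^ 2) * this

theorem exists_one_add_pow (Y : ℤ) (k : ℕ) : ∃ z : ℤ, (1 + Y) ^ k = 1 + k * Y + Y ^ 2 * z := by
  induction k with
  | zero => exact ⟨0, by simp⟩
  | succ k ih =>
    obtain ⟨z, hz⟩ := ih
    exact ⟨z * (1 + Y) + k, by rw [pow_succ, hz]; push_cast; ring⟩

/-- The extra factor `t + 1` turns the power occurring in the exponent into `(t + 1) ^ (t + 3)`,
which is close to `1` 3-adically because `3 ^ (r + 3) ∣ t + 3`. The cofactor is `-k` modulo `3`. -/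
theorem exponent_three_part {t r k : ℕ} (ht : 0 < t) (hr : t + 3 = 3 ^ (r + 3) * k)
    (hk : ¬ 3 ∣ k) : ∃ U : ℤ, ¬ 3 ∣ U ∧
      ((t : ℤ) + 1) * (((t : ℤ) + 1) ^ (t + 2) - powSum (t + 1) (t + 1)) = 3 ^ (r + 4) * U := by
  have hrZ : (t : ℤ) + 3 = 3 ^ (r + 3) * k := by exact_mod_cast hr
  have h27 : (27 : ℤ) ∣ t + 3 := ⟨3 ^ r * k, by rw [hrZ]; ring⟩
  obtain ⟨g, hg⟩ := pow_three_pow_sub_one h27 (r + 2)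
  obtain ⟨j, hj⟩ := h27
  set Y : ℤ := 3 ^ (r + 3) * t * (1 + 9 * g) with hY
  obtain ⟨z, hz⟩ := exists_one_add_pow Y k
  have hε : ((t : ℤ) + 1) ^ (t + 3) = 1 + k * Y + Y ^ 2 * z := by
    rw [hr, pow_mul, ← hz]; congr 1; linear_combination hg
  set y : ℤ := 3 ^ (r + 1) * t * (1 + 9 * g) with hy
  have hYy : Y = 9 * y := by rw [hY, hy]; ring
  refine ⟨-k + 3 * (3 * j * k + (3 * j * 3 - 4 + 2 * 9 * j) * (g * (k + 9 * y * z) + y * z)), ?_, ?_⟩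
  · intro hd
    apply hk
    have : (3 : ℤ) ∣ k := by
      have := (dvd_add_left (Dvd.intro _ rfl)).1 hd
      exact (dvd_neg.1 this)
    exact_mod_cast this
  · have ht' : (t : ℤ) ≠ 0 := by exact_mod_cast ht.ne'
    apply mul_right_cancel₀ ht'
    rw [mul_assoc, macdonald_exponent_pos]
    have e1 : ((t : ℤ) + 1) * ((t + 1) * ((t + 1) ^ (t + 1) * (t - 1) + 1)) =
        ((t : ℤ) + 1) ^ (t + 3) * (t - 1) + (t + 1) ^ 2 := by ring
    have e2 : ((t : ℤ) + 1) ^ (t + 3) * (t - 1) + (t + 1) ^ 2 =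
        3 ^ (r + 3) * t * ((t - 1) * (1 + 9 * g) * (k + 9 * y * z) + k) := by
      rw [hε, ← hYy, hY]
      linear_combination (t : ℤ) * hrZ
    rw [e1, e2]
    have e3 : (t : ℤ) = 27 * j - 3 := by linear_combination hj
    have e4 : ((t : ℤ) - 1) * (1 + 9 * g) * (k + 9 * y * z) + k = 3 * (-k + 3 * (3 * j * k + (3 * j * 3 - 4 + 2 * 9 * j) * (g * (k + 9 * y * z) + y * z))) := by
      clear_value y
      rw [e3]; ring
    rw [e4]; ring

theorem powSum_sub_eq (t : ℤ) (n : ℕ) : ∃ z : ℤ,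
    6 * (powSum (t + 1) n - n) =
      3 * t * n * (n + 1) + t ^ 2 * ((n + 1) * n * (n - 1)) + 6 * t ^ 3 * z := by
  have h : ∀ n : ℕ, ∃ z : ℤ, 2 * (t + 1) ^ n = 2 + 2 * n * t + n * (n - 1) * t ^ 2 + 2 * t ^ 3 * z := by
    intro n
    induction n with
    | zero => exact ⟨0, by simp⟩
    | succ n ih =>
      obtain ⟨z, hz⟩ := ih
      obtain ⟨q, hq⟩ : ∃ q : ℤ, (n : ℤ) * (n - 1) = q + q := by
        have := Int.even_mul_pred_self (n : ℤ); exact this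
      refine ⟨z * (t + 1) + q, ?_⟩
      rw [pow_succ, ← mul_assoc, hz]; push_cast
      linear_combination t ^ 3 * hq
  induction n with
  | zero => exact ⟨0, by simp [powSum]⟩
  | succ n ih =>
    obtain ⟨z, hz⟩ := ih
    obtain ⟨z', hz'⟩ := h (n + 1)
    refine ⟨z + z', ?_⟩
    have : powSum (t + 1) (n + 1) = powSum (t + 1) n + (t + 1) ^ (n + 1) :=
      Finset.sum_range_succ _ _
    rw [this]; push_cast at hz' ⊢
    linear_combination hz + 3 * hz'

theorem powSum_sub_eq_two (t : ℤ) (n : ℕ) : ∃ z : ℤ,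
    2 * (powSum (t + 1) n - n) = t * n * (n + 1) + 2 * t ^ 2 * z := by
  induction n with
  | zero => exact ⟨0, by simp [powSum]⟩
  | succ n ih =>
    obtain ⟨z, hz⟩ := ih
    obtain ⟨z', hz'⟩ := exists_one_add_pow t (n + 1)
    refine ⟨z + z', ?_⟩
    have : powSum (t + 1) (n + 1) = powSum (t + 1) n + (t + 1) ^ (n + 1) :=
      Finset.sum_range_succ _ _
    rw [this, add_comm t 1] at *; push_cast at hz' ⊢
    linear_combination hz + 2 * hz'

theorem pow_dvd_geom_sum_mul {q : ℕ} {β : ℤ} (h : (q : ℤ) ∣ β - 1) (k m : ℕ) :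
    (q : ℤ) ^ k ∣ ∑ i ∈ Finset.range (q ^ k * m), β ^ i := by
  rw [geom_sum_range_mul]
  exact (pow_dvd_geom_sum h k).mul_right _

/-- The first two terms contribute `α + α ^ 2 - 2 = (α + 2) * (α - 1)`; the remaining geometric sum
has length divisible by `3 ^ r`. -/
theorem three_pow_dvd_powSum_sub {α : ℤ} (hα : 3 ∣ α - 1) {r q : ℕ}
    (h : (3 : ℤ) ^ r ∣ (α + 2) * (α - 1)) :
    (3 : ℤ) ^ r ∣ powSum α (2 + 3 ^ r * q) - (2 + 3 ^ r * q : ℕ) := by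
  have h1 : powSum α (2 + 3 ^ r * q) =
      α + α ^ 2 + α ^ 3 * ∑ i ∈ Finset.range (3 ^ r * q), α ^ i := by
    rw [powSum, Finset.sum_range_add, Finset.mul_sum]
    congr 1
    · simp [Finset.sum_range_succ]
    · exact Finset.sum_congr rfl fun i _ => by ring
  have h2 : (3 : ℤ) ^ r ∣ ∑ i ∈ Finset.range (3 ^ r * q), α ^ i := by
    exact_mod_cast pow_dvd_geom_sum_mul (q := 3) (by exact_mod_cast hα) r q
  have h3 : powSum α (2 + 3 ^ r * q) - (2 + 3 ^ r * q : ℕ) = (α + 2) * (α - 1) +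
      (α ^ 3 * (∑ i ∈ Finset.range (3 ^ r * q), α ^ i) - 3 ^ r * q) := by
    rw [h1]; push_cast; ring
  rw [h3]
  exact dvd_add h (dvd_sub (h2.mul_left _) (Dvd.intro _ rfl))

/-- Since `α ^ 81 ≡ 1` mod `81`, `n` may be replaced by `2`, and `2 * α ^ 4 - (1 + α ^ 2)` is `27`
at `α = -2`. -/
theorem modEq_twenty_seven {α : ℤ} (hα : 27 ∣ α + 2) (q : ℕ) :
    let n := 2 + 81 * q
    n * α ^ (n * n) - ∑ i ∈ Finset.range n, α ^ (n * i) ≡ 27 [ZMOD 81] := by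
  intro n
  obtain ⟨j, hj⟩ := hα
  obtain rfl : α = 27 * j - 2 := by linear_combination hj
  set α : ℤ := 27 * j - 2 with hα
  have h3 : ((3 : ℕ) : ℤ) ∣ α - 1 := ⟨9 * j - 1, by rw [hα]; push_cast; ring⟩
  have h81 : α ^ 81 ≡ 1 [ZMOD 81] := by
    have := pow_succ_dvd_pow_sub_one h3 4
    norm_num at this
    exact (Int.modEq_iff_dvd.2 ((by norm_num : (81 : ℤ) ∣ 243).trans this)).symm
  have h81' : ∀ x y : ℕ, α ^ (x + 81 * y) ≡ α ^ x [ZMOD 81] := by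
    intro x y
    rw [pow_add, pow_mul]
    simpa using (h81.pow y).mul_left (α ^ x)
  have hn : α ^ n ≡ α ^ 2 [ZMOD 81] := h81' 2 q
  have hnn : α ^ (n * n) ≡ α ^ 4 [ZMOD 81] := by
    rw [show n * n = 4 + 81 * (4 * q + 81 * q * q) by simp only [n]; ring]
    exact h81' _ _
  have hsum : ∑ i ∈ Finset.range n, α ^ (n * i) ≡ 1 + α ^ 2 [ZMOD 81] := by
    simp only [pow_mul α n]
    have e : ∑ i ∈ Finset.range n, (α ^ n) ^ i =
        1 + α ^ n + (α ^ n) ^ 2 * ∑ i ∈ Finset.range (81 * q), (α ^ n) ^ i := by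
      rw [Finset.sum_range_add, Finset.mul_sum]
      congr 1
      · simp [Finset.sum_range_succ]
      · exact Finset.sum_congr rfl fun i _ => by ring
    have h4 : (81 : ℤ) ∣ ∑ i ∈ Finset.range (81 * q), (α ^ n) ^ i := by
      have := pow_dvd_geom_sum_mul (q := 3) (β := α ^ n)
        (h3.trans (sub_one_dvd_pow_sub_one _ _)) 4 q
      norm_num at this
      exact this
    rw [e]
    have := (hn.add_left 1).add ((Int.modEq_zero_iff_dvd.2 h4).mul_left ((α ^ n) ^ 2))
    simpa using this
  have hnZ : (n : ℤ) ≡ 2 [ZMOD 81] := by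
    simp only [n]; push_cast
    exact (Int.modEq_iff_dvd.2 ⟨q, by ring⟩).symm
  refine ((hnZ.mul hnn).sub hsum).trans ?_
  refine (Int.modEq_iff_dvd.2 ?_).symm
  exact ⟨j * (13122 * j ^ 3 - 3888 * j ^ 2 + 423 * j - 20), by rw [hα]; ring⟩

/-! ### Climbing the upper central series. -/

namespace IsMacdonaldTriple

variable {H : Type*} [Group H] {α : ℤ} {a b c : H}

theorem upperCentralSeries_eq_top (h : IsMacdonaldTriple α a b c)
    (hg : closure ({a, b} : Set H) = ⊤) {i : ℕ}
    (ha : a ^ (α - 1) ∈ Subgroup.upperCentralSeries H i)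
    (hb : b ^ (α - 1) ∈ Subgroup.upperCentralSeries H i) :
    Subgroup.upperCentralSeries H (i + 2) = ⊤ := by
  have := h.mem_upperCentralSeries_add_two hg (y := 1) ha hb (by simp) (by simp [powSum])
  rw [eq_top_iff, ← hg, closure_le]
  rintro x (rfl | rfl)
  · simpa using this.1
  · simpa using this.2

theorem upperCentralSeries_five_eq_top {t : ℕ} {D : ℤ}
    (h : IsMacdonaldTriple ((t : ℤ) + 1) a b c) (hg : closure ({a, b} : Set H) = ⊤)
    (hD : IsHalfSq t D) (hZ : D ∈ centralExponents a b) :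
    Subgroup.upperCentralSeries H 5 = ⊤ := by
  have e : (t : ℤ) ^ 2 ∣ ((t : ℤ) + 1) ^ t - 1 := by
    simpa using pow_succ_dvd_pow_sub_one (q := t) (β := (t : ℤ) + 1) (by simp) 1
  have hZa := hZ.1
  have hZb := hZ.2
  rw [← Subgroup.upperCentralSeries_one] at hZa hZb
  have h3 := h.mem_upperCentralSeries_add_two hg (y := t) hZa hZb (hD.dvd_sq.trans e) (by
    obtain ⟨z, hz⟩ := powSum_sub_eq_two t t
    apply Int.dvd_of_mul_dvd_mul_left (a := 2) (by norm_num)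
    rw [hz, show (t : ℤ) * t * (t + 1) = t ^ 2 * (t + 1) by ring, mul_assoc 2]
    exact dvd_add hD.two_mul_dvd (mul_dvd_mul_left 2 (hD.dvd_sq.mul_right z)))
  exact h.upperCentralSeries_eq_top hg (by simpa using h3.1) (by simpa using h3.2)

theorem upperCentralSeries_seven_eq_top {u : ℕ} {D : ℤ}
    (h : IsMacdonaldTriple (((3 * u : ℕ) : ℤ) + 1) a b c) (hg : closure ({a, b} : Set H) = ⊤)
    (hD : IsHalfSq ((3 * u : ℕ) : ℤ) D) (hZ : 3 * D ∈ centralExponents a b) :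
    Subgroup.upperCentralSeries H 7 = ⊤ := by
  have hu : ((3 * u : ℕ) : ℤ) = 3 * u := by push_cast; rfl
  set t := 3 * u with ht
  obtain ⟨k, e⟩ : (t : ℤ) ^ 2 ∣ ((t : ℤ) + 1) ^ t - 1 := by
    simpa using pow_succ_dvd_pow_sub_one (q := t) (β := (t : ℤ) + 1) (by simp) 1
  have hZa := hZ.1
  have hZb := hZ.2
  rw [← Subgroup.upperCentralSeries_one] at hZa hZb
  have h3 := h.mem_upperCentralSeries_add_two hg (y := 3 * t) hZa hZb
    (by
      have : 3 * (t : ℤ) ^ 2 ∣ ((t : ℤ) + 1) ^ (3 * t) - 1 := by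
        refine ⟨k * (1 + t ^ 2 * k + 3 * u ^ 2 * t ^ 2 * k ^ 2), ?_⟩
        rw [mul_comm 3 t, pow_mul, sub_eq_iff_eq_add.1 e, hu]; ring
      exact (mul_dvd_mul_left 3 hD.dvd_sq).trans this)
    (by
      obtain ⟨z, hz⟩ := powSum_sub_eq t (3 * t)
      apply Int.dvd_of_mul_dvd_mul_left (a := 6) (by norm_num)
      rw [hz]
      obtain ⟨p, hp⟩ := hD.dvd_sq
      obtain ⟨q, hq⟩ := hD.two_mul_dvd
      refine ⟨q + t * p + u * (q * (9 * t - 9) + 4 * p) + u * p * z, ?_⟩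
      push_cast
      linear_combination (9 + 9 * (u : ℤ) * (9 * t - 9)) * hq +
        (18 * (t : ℤ) + 72 * u + 18 * u * z) * hp +
        (3 * (t : ℤ) ^ 2 * (9 * t ^ 2 - 1) + 6 * t ^ 2 * z) * hu)
  have h5 := h.mem_upperCentralSeries_add_two hg (i := 3) (x := ((3 * t : ℕ) : ℤ)) (y := t)
    (by rw [zpow_natCast]; exact h3.1) (by rw [zpow_natCast]; exact h3.2)
    (by
      refine ⟨u * k, ?_⟩
      rw [e]; push_cast [ht]; ring)
    (by
      obtain ⟨z, hz⟩ := powSum_sub_eq_two t t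
      obtain ⟨p, hp⟩ : Even ((u : ℤ) * (t + 1)) := by
        rw [hu, Int.even_mul]
        rcases Int.even_or_odd (u : ℤ) with h | h
        · exact Or.inl h
        · exact Or.inr (((by decide : Odd (3 : ℤ)).mul h).add_odd odd_one)
      refine ⟨p + u * z, ?_⟩
      apply mul_left_cancel₀ (two_ne_zero (α := ℤ))
      rw [hz]; push_cast
      linear_combination 3 * (t : ℤ) * hp + ((t : ℤ) * (t + 1) + 2 * t * z) * hu)
  exact h.upperCentralSeries_eq_top hg (by simpa using h5.1) (by simpa using h5.2)

theorem mem_centralExponents_of_isCoprime {t w : ℕ} (ha : a ^ t ^ w = 1) (hb : b ^ t ^ w = 1)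
    {d x : ℤ} (hx : d * x ∈ centralExponents a b) (hc : IsCoprime x t) :
    d ∈ centralExponents a b := by
  have ht : (t : ℤ) ^ w ∈ centralExponents a b := by
    constructor
    · rw [← Nat.cast_pow, zpow_natCast, ha]; exact one_mem _
    · rw [← Nat.cast_pow, zpow_natCast, hb]; exact one_mem _
  exact AddSubgroup.mem_of_isCoprime_int hx (AddSubgroup.mem_of_dvd_int ht (Dvd.intro_left d rfl))
    hc.pow_right

/-- The exceptional case. With `D = 9 * E`, the first source gives `3 ^ (r + 4) * E`, and the second
lowers the power of `3` to `27`. -/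
theorem three_mul_mem_centralExponents {u : ℕ} (hu : 0 < u) {D : ℤ}
    (h : IsMacdonaldTriple (((3 * u : ℕ) : ℤ) + 1) a b c) (hg : closure ({a, b} : Set H) = ⊤)
    (hD : IsHalfSq ((3 * u : ℕ) : ℤ) D) (h9 : (9 : ℤ) ∣ u + 1) {f : ℕ}
    (hf : D * 3 ^ f ∈ centralExponents a b) : 3 * D ∈ centralExponents a b := by
  have hu3 : ¬ 3 ∣ u := by omega
  obtain ⟨E, rfl⟩ : (9 : ℤ) ∣ D := by
    have h1 : (9 : ℤ) ∣ 2 * D := by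
      refine Dvd.dvd.trans ⟨(u : ℤ) ^ 2, ?_⟩ hD.sq_dvd
      push_cast; ring
    omega
  have hE : E ∣ (u : ℤ) ^ 2 := by
    have := hD.dvd_sq
    rw [show ((3 * u : ℕ) : ℤ) ^ 2 = 9 * (u : ℤ) ^ 2 by push_cast; ring] at this
    exact Int.dvd_of_mul_dvd_mul_left (by norm_num) this
  have h3u : IsCoprime (3 : ℤ) (u : ℤ) := by
    exact_mod_cast Nat.isCoprime_iff_coprime.2
      ((Nat.Prime.coprime_iff_not_dvd Nat.prime_three).2 hu3)
  have h3E : IsCoprime (3 : ℤ) E := IsCoprime.of_isCoprime_of_dvd_right h3u.pow_right hE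
  have hprime : ∀ U : ℤ, ¬ 3 ∣ U → ∀ m : ℕ, IsCoprime U (3 ^ m) := fun U hU m =>
    ((Int.prime_three.coprime_iff_not_dvd).2 hU).symm.pow_right
  obtain ⟨r, k, hk, hr⟩ : ∃ r k : ℕ, ¬ 3 ∣ k ∧ 3 * u + 3 = 3 ^ (r + 3) * k := by
    obtain ⟨j, hj⟩ : 27 ∣ 3 * u + 3 := by omega
    obtain ⟨r, k, hk, hjk⟩ := Nat.exists_eq_pow_mul_and_not_dvd (n := j) (by omega) 3 (by norm_num)
    exact ⟨r, k, hk, by rw [hj, hjk]; ring⟩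
  obtain ⟨U, hU, hUM⟩ := exponent_three_part (by omega) hr hk
  have hUmem : (3 : ℤ) ^ (r + 4) * U ∈ centralExponents a b := by
    rw [← hUM]
    exact AddSubgroup.mem_of_dvd_int (h.mem_centralExponents_of_pos hg) (Dvd.intro_left _ rfl)
  have h1 : (3 : ℤ) ^ (r + 4) * E ∈ centralExponents a b :=
    AddSubgroup.mem_of_isCoprime_int (x := U) (y := 3 ^ f)
      (AddSubgroup.mem_of_dvd_int hUmem ⟨E, by ring⟩)
      (AddSubgroup.mem_of_dvd_int hf ⟨3 ^ (r + 2), by ring⟩) (hprime U hU f)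
  have hcop : Nat.Coprime (3 ^ (r + 4)) (2 * u ^ 2) := by
    refine Nat.Coprime.pow_left _ (Nat.Coprime.mul_right (by norm_num) (Nat.Coprime.pow_right _ ?_))
    exact (Nat.Prime.coprime_iff_not_dvd Nat.prime_three).2 hu3
  -- `n ≡ 2` handles the factor `3 ^ (r + 4)` of `powSum α n - n`, and `2 * u ^ 2 ∣ n` handles `E`.
  obtain ⟨n, hn1, hn2⟩ := Nat.chineseRemainder hcop 2 0
  obtain ⟨m, rfl⟩ : ∃ m, n = 2 + 3 ^ (r + 4) * m := by
    have h2 : 2 < 3 ^ (r + 4) := by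
      have := Nat.pow_le_pow_right (n := 3) (by norm_num) (by omega : 1 ≤ r + 4)
      omega
    have h3 : n % 3 ^ (r + 4) = 2 := by rw [hn1, Nat.mod_eq_of_lt h2]
    exact ⟨n / 3 ^ (r + 4), by have := Nat.mod_add_div n (3 ^ (r + 4)); omega⟩
  have hα2 : (27 : ℤ) ∣ ((3 * u : ℕ) : ℤ) + 1 + 2 := by push_cast; omega
  have hr' : (3 : ℤ) * u + 3 = 3 ^ (r + 3) * k := by exact_mod_cast hr
  set n := 2 + 3 ^ (r + 4) * m with hn
  have hs : powSum (((3 * u : ℕ) : ℤ) + 1) n - n ∈ centralExponents a b := by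
    refine AddSubgroup.mem_of_dvd_int h1 (IsCoprime.mul_dvd h3E.pow_left ?_ ?_)
    · refine three_pow_dvd_powSum_sub ⟨u, by push_cast; ring⟩ ⟨k * u, ?_⟩
      push_cast
      linear_combination 3 * (u : ℤ) * hr'
    · obtain ⟨z, hz⟩ := powSum_sub_eq_two ((3 * u : ℕ) : ℤ) n
      obtain ⟨q, hq⟩ := (Nat.modEq_zero_iff_dvd.1 hn2)
      have hq' : (n : ℤ) = 2 * u ^ 2 * q := by exact_mod_cast hq
      refine hE.trans ⟨3 * u * q * (n + 1) + 9 * z, ?_⟩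
      apply mul_left_cancel₀ (two_ne_zero (α := ℤ))
      rw [hz]; push_cast
      linear_combination 3 * (u : ℤ) * (n + 1) * hq'
  have hR := h.mem_centralExponents_of_central hg hs
  have hmod := modEq_twenty_seven hα2 (3 ^ r * m)
  rw [show 2 + 81 * (3 ^ r * m) = n by rw [hn]; ring] at hmod
  obtain ⟨v, hv⟩ := Int.modEq_iff_dvd.1 hmod.symm
  have hR' : (27 : ℤ) * (1 + 3 * v) ∈ centralExponents a b := by
    convert hR using 1
    linear_combination -hv
  have := AddSubgroup.mem_of_isCoprime_int (d := 27 * E) (x := 1 + 3 * v) (y := 3 ^ (r + 1))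
    (AddSubgroup.mem_of_dvd_int hR' ⟨E, by ring⟩)
    (AddSubgroup.mem_of_dvd_int h1 ⟨1, by ring⟩)
    (hprime _ (by omega) _)
  rwa [show 3 * (9 * E) = 27 * E by ring]

theorem upperCentralSeries_seven_eq_top_of_pos {t : ℕ} (ht : 0 < t)
    (h : IsMacdonaldTriple ((t : ℤ) + 1) a b c) (hg : closure ({a, b} : Set H) = ⊤) :
    Subgroup.upperCentralSeries H 7 = ⊤ := by
  obtain ⟨K, hK, haK, hbK⟩ := h.exists_pow_eq_one hg (by omega)
  obtain ⟨w, ha, hb⟩ := h.exists_pow_pow_eq_one hK haK hbK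
  have hα : IsCoprime ((t : ℤ) + 1) t := ⟨1, -1, by ring⟩
  have hM : ∀ {D V k : ℤ}, k * (((t : ℤ) + 1) ^ (t + 2) - powSum (t + 1) (t + 1)) =
      ((t : ℤ) + 1) * (D * V) → D * V ∈ centralExponents a b := by
    intro D V k hk
    refine mem_centralExponents_of_isCoprime ha hb (x := (t : ℤ) + 1) ?_ hα
    rw [mul_comm, ← hk]
    exact AddSubgroup.mem_of_dvd_int (h.mem_centralExponents_of_pos hg) (Dvd.intro_left _ rfl)
  by_cases h3 : 3 ∣ t
  · obtain ⟨u, rfl⟩ := h3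
    obtain ⟨D, V, k, hk, hD, h9, hV⟩ := exists_factor_of_three_dvd (u := u) (by omega)
    have hDV := hM hk
    refine h.upperCentralSeries_seven_eq_top hg hD ?_
    have hsplit : ∀ x y : ℤ, V = x * y → ¬ 3 ∣ y → D * x ∈ centralExponents a b := by
      intro x y hxy hy
      refine mem_centralExponents_of_isCoprime ha hb (x := y) ?_ (hV y ⟨x, by rw [hxy]; ring⟩ hy)
      rwa [mul_assoc, ← hxy]
    by_cases hu9 : (9 : ℤ) ∣ u + 1
    · obtain ⟨f, y, hy, hVy⟩ : ∃ (f : ℕ) (y : ℤ), ¬ 3 ∣ y ∧ V = 3 ^ f * y := by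
        -- If `V = 0`, then `u` would be coprime to `3 * u`, hence a unit, contradicting `9 ∣ u +
        -- 1`.
        have hV0 : V ≠ 0 := by
          rintro rfl
          have := (hV u (dvd_zero _) (by omega)).symm.isUnit_of_dvd'
            (Dvd.intro_left 3 (by push_cast; rfl)) dvd_rfl
          rw [Int.isUnit_iff] at this
          omega
        obtain ⟨y, h1, h2⟩ := (Int.finiteMultiplicity_iff (a := 3) (b := V)
          |>.2 ⟨by norm_num, hV0⟩).exists_eq_pow_mul_and_not_dvd
        exact ⟨_, y, h2, h1⟩
      exact h.three_mul_mem_centralExponents (by omega) hg hD hu9 (hsplit _ _ hVy hy)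
    · by_cases hV3 : (3 : ℤ) ∣ V
      · obtain ⟨y, hy⟩ := hV3
        rw [mul_comm]
        refine hsplit 3 y hy fun ⟨z, hz⟩ => hu9 (h9 ⟨z, by rw [hy, hz]; ring⟩)
      · exact AddSubgroup.mem_of_dvd_int (hsplit 1 V (by ring) hV3) ⟨3, by ring⟩
  · obtain ⟨D, V, k, hk, hD, hV⟩ := exists_factor_of_not_three_dvd ht h3
    have := h.upperCentralSeries_five_eq_top hg hD
      (mem_centralExponents_of_isCoprime ha hb (hM hk) hV)
    exact top_le_iff.1 (this ▸ Subgroup.upperCentralSeries_mono H (by norm_num : 5 ≤ 7))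

theorem upperCentralSeries_seven_eq_top_of_closure (h : IsMacdonaldTriple α a b c)
    (hg : closure ({a, b} : Set H) = ⊤) : Subgroup.upperCentralSeries H 7 = ⊤ := by
  by_cases hα : α = 1
  · subst hα
    have := h.upperCentralSeries_eq_top hg (i := 0) (by simp) (by simp)
    exact top_le_iff.1 (this ▸ Subgroup.upperCentralSeries_mono H (by norm_num : 0 + 2 ≤ 7))
  · obtain ⟨K, hK, ha, hb⟩ := h.exists_pow_eq_one hg hα
    have h' := h.of_zpow_eq_one (K := K) (by rwa [zpow_natCast]) (by rwa [zpow_natCast])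
      (α.natAbs + 2)
    have hle : (α.natAbs : ℤ) + 2 ≤ K * (α.natAbs + 2) :=
      le_mul_of_one_le_left (by positivity) (by exact_mod_cast hK)
    have h1 : 0 < α + K * (α.natAbs + 2) - 1 := by omega
    have h2 : (((α + K * (α.natAbs + 2) - 1).toNat : ℤ)) + 1 = α + K * (α.natAbs + 2) := by
      rw [Int.toNat_of_nonneg h1.le]; ring
    rw [← h2] at h'
    exact h'.upperCentralSeries_seven_eq_top_of_pos (by omega) hg

end IsMacdonaldTriple

/-! ### Application to the presented group. -/

theorem macdonaldGroup_isMacdonaldTriple (α : ℤ) :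
    let A : MacdonaldGroup α := PresentedGroup.of 0
    let B : MacdonaldGroup α := PresentedGroup.of 1
    IsMacdonaldTriple α A B (groupComm A B) := by
  intro A B
  have h1 : rightConj A (groupComm A B) * (A ^ α)⁻¹ = 1 :=
    PresentedGroup.one_of_mem (rels := macdonaldRels α) (Set.mem_insert _ _)
  have h2 : rightConj B (groupComm B A) * (B ^ α)⁻¹ = 1 :=
    PresentedGroup.one_of_mem (rels := macdonaldRels α) (Set.mem_insert_of_mem _ rfl)
  rw [mul_inv_eq_one] at h1 h2
  refine ⟨by unfold groupComm; group, ?_, ?_⟩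
  · rw [← h1]; unfold rightConj; group
  · rw [← h2]; unfold rightConj groupComm; group

theorem macdonaldGroup_closure (α : ℤ) :
    closure ({PresentedGroup.of 0, PresentedGroup.of 1} : Set (MacdonaldGroup α)) = ⊤ := by
  rw [← PresentedGroup.closure_range_of]
  congr 1
  ext x
  simp [Set.mem_range, Fin.exists_fin_two, eq_comm]

theorem theorem3p2 (α : ℤ) :
    Group.IsNilpotent (MacdonaldGroup α) ∧ Group.nilpotencyClass (MacdonaldGroup α) ≤ 7 := by
  have h := (macdonaldGroup_isMacdonaldTriple α).upperCentralSeries_seven_eq_top_of_closure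
    (macdonaldGroup_closure α)
  have hn : Group.IsNilpotent (MacdonaldGroup α) := ⟨7, h⟩
  exact ⟨hn, Subgroup.upperCentralSeries_eq_top_iff_nilpotencyClass_le.1 h⟩
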